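/- **Setting.** Let $M\in\mathbb N$, $\Omega_M=\{1,\dots,M\}$, let $\mathcal A$ be a finite set of actions, and let $\mathcal Z$ be an observation space with a $\sigma$-finite reference measure $dz$. For each $a\in\mathcal A$ and $i\in\Omega_M$ let $q^a_i$ be a probability density on $\mathcal Z$. All logarithms are in base $2$, $[x]^+=\max\{x,0\}$, and $$D(q\|q')=\int_{\mathcal Z} q(z)\log\frac{q(z)}{q'(z)}\,dz\in[0,\infty]$$ is the Kullback--Leibler divergence. An unknown hypothesis $\theta\in\Omega_M$ has prior $\rho=(\rho_1,\dots,\rho_M)$, a probability vector. At each time $t=0,1,2,\dots$, on the basis of the past actions and observations and possibly with randomization, a decision maker either retires or selects an action $A(t)\in\mathcal A$; in the latter case an observation $Z(t)$ is drawn, whose conditional density given the past, $A(t)=a$ and $\theta=i$ is $q^a_i$. Let $\tau$ be the time of retirement; at that time a hypothesis $d=d(A(0),Z(0),\dots,A(\tau-1),Z(\tau-1))\in\Omega_M$ is declared. For a penalty $L>0$ the expected total cost is $\mathbb E[\tau]+L\,P(d\neq\theta)$, and the optimal cost $V^*(\rho)$ is its infimum over all such strategies. Put $$\mathbb P_L(\Omega_M)=\Big\{\rho\in[0,1]^M:\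 \sum_i\rho_i=1,\ \min_{j}(1-\rho_j)L>1\Big\}.$$ **Theorem.** Assume that for any two hypotheses $i\neq j$ there is an action $a\in\mathcal A$ with $D(q^a_i\|q^a_j)>0$. Then there is a constant $K'_1\in\mathbb R$, depending on $M$, $\mathcal A$ and the densities $q^a_i$ but neither on $L$ nor on $\rho$, such that for all $L>1$ and all $\rho\in\mathbb P_L(\Omega_M)$, $$V^*(\rho)\ \ge\ \Bigg[\sum_{i=1}^M\rho_i\max_{j\neq i}\frac{\log\big((1-L^{-1})/L^{-1}\big)-\log(\rho_i/\rho_j)}{\max_{a\in\mathcal A}D(q^a_i\|q^a_j)}-K'_1\Bigg]^+ .$$ Here $\log\frac b0=\infty$ for $b>0$; the $i$-th summand is $0$ if $\rho_i=0$; and a quotient with denominator $\infty$ is $0$. -/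

import Mathlib

open scoped ENNReal NNReal
open MeasureTheory ProbabilityTheory

noncomputable section

namespace ActiveTesting

/-- The data of an active `M`-ary hypothesis testing problem: a reference measure `ν` on the
observation space `Z` and, for every action `a` and hypothesis `i`, the probability density
`q a i` (with respect to `ν`) of the observation when action `a` is taken and `i` is true. -/
structure Model (M : ℕ) (A Z : Type*) [MeasurableSpace Z] where
  ν : Measure Z
  sigmaFinite : SigmaFinite ν
  q : A → Fin M → Z → ℝ≥0
  measurable_q : ∀ a i, Measurable (q a i)
  lintegral_q : ∀ a i, ∫⁻ z, (q a i z : ℝ≥0∞) ∂ν = 1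

/-- A (history dependent, randomized) strategy. Given the past actions and observations at time
`t`, the kernel `ctrl t` draws a pair `(b, a)`: if `b = true` the decision maker retires at time
`t`, otherwise action `a` is taken. Upon retiring at time `t`, hypothesis `decl t h` is declared,
`h` being the record of the actions and observations made so far. -/
structure Strategy (M : ℕ) (A Z : Type*) [MeasurableSpace A] [MeasurableSpace Z] where
  ctrl : (t : ℕ) → Kernel (Fin t → A × Z) (Bool × A)
  markov_ctrl : ∀ t, IsMarkovKernel (ctrl t)
  decl : (t : ℕ) → (Fin t → A × Z) → Fin M
  measurable_decl : ∀ t, Measurable (decl t)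

/-- What is recorded at one instant: ((retirement flag, action), observation). The process is run
forever; what it does from the retirement time on has no influence on the cost. -/
abbrev Step (A Z : Type*) : Type _ := (Bool × A) × Z

/-- The actions and observations before time `t` along a trajectory. -/
def history {A Z : Type*} (t : ℕ) (x : ℕ → Step A Z) : Fin t → A × Z :=
  fun k => ((x k).1.2, (x k).2)

/-- The retirement time: the first `t` at which the retirement flag is raised. -/
def retireTime {A Z : Type*} (x : ℕ → Step A Z) : ℕ∞ :=
  ⨅ (t : ℕ) (_ : (x t).1.1 = true), (t : ℕ∞)

/-- The actions and observations at the times `0, …, n`. -/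
def historyIic {A Z : Type*} (n : ℕ) (x : (k : Finset.Iic n) → Step A Z) :
    Fin (n + 1) → A × Z :=
  fun k => ((x ⟨k, Finset.mem_Iic.2 (Nat.lt_succ_iff.1 k.2)⟩).1.2,
    (x ⟨k, Finset.mem_Iic.2 (Nat.lt_succ_iff.1 k.2)⟩).2)

theorem measurable_historyIic {A Z : Type*} [MeasurableSpace A] [MeasurableSpace Z] (n : ℕ) :
    Measurable (historyIic (A := A) (Z := Z) n) := by
  unfold historyIic
  fun_prop

section

variable {M : ℕ} {A Z : Type*} [MeasurableSpace Z]

/-- The law of the observation when action `a` is taken and hypothesis `i` is true. -/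
def Model.obs (S : Model M A Z) (a : A) (i : Fin M) : Measure Z :=
  S.ν.withDensity fun z => (S.q a i z : ℝ≥0∞)

instance Model.isProbabilityMeasure_obs (S : Model M A Z) (a : A) (i : Fin M) :
    IsProbabilityMeasure (S.obs a i) :=
  ⟨by rw [Model.obs, withDensity_apply _ MeasurableSet.univ, Measure.restrict_univ,
    S.lintegral_q]⟩

/-- The Kullback–Leibler divergence `D(q^a_i ‖ q^a_j) ∈ [0, ∞]`, in bits. -/
def Model.D (S : Model M A Z) (a : A) (i j : Fin M) : ℝ≥0∞ :=
  InformationTheory.klDiv (S.obs a i) (S.obs a j) / ENNReal.ofReal (Real.log 2)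

variable [Finite A] [MeasurableSpace A] [MeasurableSingletonClass A]

/-- The observation law under hypothesis `i` as a kernel from actions to observations. -/
def Model.obsKernel (S : Model M A Z) (i : Fin M) : Kernel A Z :=
  Kernel.ofFunOfCountable fun a => S.obs a i

instance Model.isMarkovKernel_obsKernel (S : Model M A Z) (i : Fin M) :
    IsMarkovKernel (S.obsKernel i) :=
  ⟨fun a => S.isProbabilityMeasure_obs a i⟩

/-- The law of what is recorded at time `t` given the earlier actions and observations, when
hypothesis `i` is true: the strategy draws a flag and an action `a`, then the observation is
drawn from `q^a_i`, independently of everything else. -/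
def stepKernel (S : Model M A Z) (π : Strategy M A Z) (i : Fin M) (t : ℕ) :
    Kernel (Fin t → A × Z) (Step A Z) :=
  π.ctrl t ⊗ₖ (S.obsKernel i).comap
    (fun p : (Fin t → A × Z) × (Bool × A) => p.2.2) (by fun_prop)

instance isMarkovKernel_stepKernel (S : Model M A Z) (π : Strategy M A Z) (i : Fin M) (t : ℕ) :
    IsMarkovKernel (stepKernel S π i t) := by
  have := π.markov_ctrl t
  unfold stepKernel
  infer_instance

/-- The same, as a kernel on the trajectories up to time `n`. -/
def nextKernel (S : Model M A Z) (π : Strategy M A Z) (i : Fin M) (n : ℕ) :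
    Kernel ((k : Finset.Iic n) → Step A Z) (Step A Z) :=
  (stepKernel S π i (n + 1)).comap (historyIic n) (measurable_historyIic n)

instance isMarkovKernel_nextKernel (S : Model M A Z) (π : Strategy M A Z) (i : Fin M) (n : ℕ) :
    IsMarkovKernel (nextKernel S π i n) := by
  unfold nextKernel
  infer_instance

/-- The law of the whole trajectory when hypothesis `i` is true (Ionescu-Tulcea). -/
def trajLaw (S : Model M A Z) (π : Strategy M A Z) (i : Fin M) : Measure (ℕ → Step A Z) :=
  Kernel.trajMeasure (X := fun _ => Step A Z)
    (stepKernel S π i 0 (fun k => k.elim0)) (nextKernel S π i)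

/-- The joint law of the true hypothesis `θ`, with prior `ρ`, and the trajectory. -/
def jointLaw (S : Model M A Z) (π : Strategy M A Z) (ρ : Fin M → ℝ) :
    Measure (Fin M × (ℕ → Step A Z)) :=
  ∑ i, ENNReal.ofReal (ρ i) • (Measure.dirac i).prod (trajLaw S π i)

/-- The event that the decision maker retires and declares a wrong hypothesis. -/
def wrongDeclaration (π : Strategy M A Z) : Set (Fin M × (ℕ → Step A Z)) :=
  {ω | ∃ t : ℕ, retireTime ω.2 = t ∧ π.decl t (history t ω.2) ≠ ω.1}

/-- The expected total cost `E[τ] + L · Pe` of a strategy. -/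
def cost (S : Model M A Z) (L : ℝ) (ρ : Fin M → ℝ) (π : Strategy M A Z) : ℝ≥0∞ :=
  ∫⁻ ω, (retireTime ω.2 : ℝ≥0∞) ∂(jointLaw S π ρ) +
    ENNReal.ofReal L * jointLaw S π ρ (wrongDeclaration π)

/-- The optimal value function `V*(ρ)`, for the penalty `L`. -/
def optimalCost (S : Model M A Z) (L : ℝ) (ρ : Fin M → ℝ) : ℝ≥0∞ :=
  ⨅ π : Strategy M A Z, cost S L ρ π

end

/-- The beliefs `ρ` with `min_j (1 - ρ_j) L > 1`. -/
def beliefRegion (M : ℕ) (L : ℝ) : Set (Fin M → ℝ) :=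
  {ρ | ρ ∈ stdSimplex ℝ (Fin M) ∧ ∀ j, 1 < (1 - ρ j) * L}

/-- The base-2 logarithm on `[0, ∞]`, with `log 0 = -∞` and `log ∞ = ∞`. -/
def log2 (x : ℝ≥0∞) : EReal := ENNReal.log x / ((Real.log 2 : ℝ) : EReal)

/-- The sum `∑ i, ρ_i max_{j ≠ i} (log ((1 - L⁻¹) / L⁻¹) - log (ρ_i / ρ_j)) / max_a D(q^a_i ‖ q^a_j)`
in the extended reals, where `b / 0 = ∞` for `b > 0`, `x / ∞ = 0` and `0 * x = 0`. -/
def lowerSum {M : ℕ} {A Z : Type*} [MeasurableSpace Z] (S : Model M A Z) (L : ℝ)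
    (ρ : Fin M → ℝ) : EReal :=
  ∑ i, (ρ i : EReal) * ⨆ (j : Fin M) (_ : j ≠ i),
    ((Real.logb 2 ((1 - L⁻¹) / L⁻¹) : ℝ) -
      log2 (ENNReal.ofReal (ρ i) / ENNReal.ofReal (ρ j))) / ((⨆ a, S.D a i j : ℝ≥0∞) : EReal)

end ActiveTesting

end

/-!
Distinguishing hypothesis `i` from a rival `j` requires the log-likelihood ratio of `i` against `j`
to become large, and under `i` one observation increases it on average by at most
`D = max_a D(q^a_i ‖ q^a_j)`. This is turned into a bound on the expected retirement time `T_i`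
under `i`, for each pair `i ≠ j` with `D` finite, by a Donsker–Varadhan argument. With the
log-likelihood ratio `ℓ` at the retirement time, a change of measure gives
`E_i[w exp (-ℓ)] ≤ E_j[w]` for positive `w`, so `log y ≤ y - 1` yields
`E_i[log w] - E_i[ℓ] ≤ E_j[w] - 1`. The choice `w = 1 / b` where `i` is declared and `w = 1`
elsewhere, with `b` at least the error probability under `j`, together with `E_i[ℓ] ≤ D T_i`, gives
`(1 - α_i) log (1 / b) ≤ D T_i + 1` in nats, where `α_i` is the error probability under `i`
(`one_sub_wrong_mul_log_le`).

Stopping needs no stopped process: the change of measure is applied to the unstopped ratio at every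
fixed time `t`, on the event of retiring at `t`, and the contributions are summed up to a horizon
`n`, with the trajectories still running at `n` as a boundary term (`log_mul_sum_retireCorrect_le`).
If `T_i` is finite, the mass of the latter tends to `0`.

The bound is used with `b = (Pe + 1 / L) / ρ_j`, where `Pe` is the overall error probability of the
strategy; adding `1 / L` keeps `b` positive and costs only a constant. Weighted by `ρ_i`, the result
differs from the `i`-th summand of the claim by terms which are bounded, namely `-ρ_i log ρ_i ≤ 1`
and the loss from `α_i`, and by a multiple of `log (L Pe + 1)`, which is absorbed by the penalty
`L Pe` (`mul_log_sub_log_div_le`). None of these constants depends on the prior or on `L`, because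
the largest divergences are bounded below by a positive number (`exists_pos_le_iSup_D`).
-/

noncomputable section

namespace ActiveTesting

/-! ### The Markov property of the trajectory law -/

section

variable {M : ℕ} {A Z : Type*}

/-- The recorded steps, including the retirement flags, before time `t`. -/
def past (t : ℕ) (x : ℕ → Step A Z) : Fin t → Step A Z := fun k => x k

/-- The actions and observations contained in a record of the first `t` steps. -/
def eraseFlags {t : ℕ} (y : Fin t → Step A Z) : Fin t → A × Z := fun k => ((y k).1.2, (y k).2)

/-- Everything known at time `t` once the strategy has drawn its flag and action, but before the
observation of that time is made. -/
def beforeObs (t : ℕ) (x : ℕ → Step A Z) : (Fin t → Step A Z) × (Bool × A) := (past t x, (x t).1)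

variable [MeasurableSpace A] [MeasurableSpace Z]

@[fun_prop]
theorem measurable_past (t : ℕ) : Measurable (past (A := A) (Z := Z) t) := by
  unfold past; fun_prop

@[fun_prop]
theorem measurable_eraseFlags (t : ℕ) : Measurable (eraseFlags (A := A) (Z := Z) (t := t)) := by
  unfold eraseFlags; fun_prop

@[fun_prop]
theorem measurable_beforeObs (t : ℕ) : Measurable (beforeObs (A := A) (Z := Z) t) := by
  unfold beforeObs; fun_prop

variable [Finite A] [MeasurableSingletonClass A]

instance isProbabilityMeasure_trajLaw (S : Model M A Z) (π : Strategy M A Z) (i : Fin M) :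
    IsProbabilityMeasure (trajLaw S π i) := by
  unfold trajLaw; infer_instance

theorem trajLaw_map_zero (S : Model M A Z) (π : Strategy M A Z) (i : Fin M) :
    (trajLaw S π i).map (fun x => x 0) = stepKernel S π i 0 (fun k => k.elim0) := by
  have h : (trajLaw S π i).map (Preorder.frestrictLe 0) =
      (stepKernel S π i 0 (fun k => k.elim0)).map
        (MeasurableEquiv.piUnique (fun _ : Finset.Iic 0 => Step A Z)).symm := by
    rw [trajLaw, Kernel.trajMeasure, Measure.map_comp _ _ (by fun_prop),
      Kernel.traj_map_frestrictLe, Kernel.partialTraj_self, Measure.id_comp]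
  have h2 : (fun x : ℕ → Step A Z => x 0) =
      (MeasurableEquiv.piUnique (fun _ : Finset.Iic 0 => Step A Z)) ∘ Preorder.frestrictLe 0 := rfl
  rw [h2, ← Measure.map_map (by fun_prop) (by fun_prop), h,
    Measure.map_map (by fun_prop) (by fun_prop), MeasurableEquiv.self_comp_symm, Measure.map_id]

/-- The defining Markov property of the trajectory law: given the past, the step made at time `t`
has law `stepKernel S π i t`. -/
theorem lintegral_trajLaw_step (S : Model M A Z) (π : Strategy M A Z) (i : Fin M) (t : ℕ)
    {g : (Fin t → Step A Z) × Step A Z → ℝ≥0∞} (hg : Measurable g) :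
    ∫⁻ x, g (past t x, x t) ∂(trajLaw S π i) =
      ∫⁻ x, ∫⁻ s, g (past t x, s) ∂(stepKernel S π i t (eraseFlags (past t x)))
        ∂(trajLaw S π i) := by
  -- The initial law and the later kernels are separate data of `Kernel.trajMeasure`.
  cases t with
  | zero =>
    have h1 : ∀ x : ℕ → Step A Z, past 0 x = fun k => k.elim0 := fun x =>
      funext fun k => k.elim0
    have h2 : eraseFlags (fun k : Fin 0 => (k.elim0 : Step A Z)) = fun k => k.elim0 :=
      funext fun k => k.elim0
    simp only [h1, h2, lintegral_const, measure_univ, mul_one]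
    rw [← trajLaw_map_zero, lintegral_map (by fun_prop) (by fun_prop)]
  | succ n =>
    let e : ((k : Finset.Iic n) → Step A Z) → (Fin (n + 1) → Step A Z) :=
      fun y k => y ⟨k, Finset.mem_Iic.2 (Nat.lt_succ_iff.1 k.2)⟩
    have he : Measurable e := by fun_prop
    have key := Kernel.map_frestrictLe_trajMeasure_compProd_eq_map_trajMeasure
      (X := fun _ => Step A Z) (μ₀ := stepKernel S π i 0 (fun k => k.elim0))
      (κ := nextKernel S π i) (a := n)
    have hg' : Measurable fun p : ((k : Finset.Iic n) → Step A Z) × Step A Z => g (e p.1, p.2) := by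
      fun_prop
    have := congrArg (fun μ => ∫⁻ p, g (e p.1, p.2) ∂μ) key
    rw [Measure.lintegral_compProd hg', lintegral_map hg' (by fun_prop),
      lintegral_map hg'.lintegral_kernel_prod_right' (by fun_prop)] at this
    exact this.symm

theorem lintegral_stepKernel (S : Model M A Z) (π : Strategy M A Z) (i : Fin M) (t : ℕ)
    (h : Fin t → A × Z) {f : Step A Z → ℝ≥0∞} (hf : Measurable f) :
    ∫⁻ s, f s ∂(stepKernel S π i t h) =
      ∫⁻ p, ∫⁻ z, f (p, z) ∂(S.obs p.2 i) ∂(π.ctrl t h) := by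
  have := π.markov_ctrl t
  rw [stepKernel, Kernel.lintegral_compProd _ _ _ hf]
  rfl

/-- The law of the observation kernel in the variables known just before the observation. -/
def obsAfter (S : Model M A Z) (i : Fin M) (t : ℕ) :
    Kernel ((Fin t → Step A Z) × (Bool × A)) Z :=
  (S.obsKernel i).comap (fun p => p.2.2) (by fun_prop)

instance isMarkovKernel_obsAfter (S : Model M A Z) (i : Fin M) (t : ℕ) :
    IsMarkovKernel (obsAfter S i t) := by
  unfold obsAfter; infer_instance

/-- Given the past and the action of time `t`, the observation is drawn from the density of that
action under the true hypothesis. -/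
theorem trajLaw_map_beforeObs_compProd (S : Model M A Z) (π : Strategy M A Z) (i : Fin M) (t : ℕ) :
    (trajLaw S π i).map (fun x => (beforeObs t x, (x t).2)) =
      (trajLaw S π i).map (beforeObs t) ⊗ₘ obsAfter S i t := by
  refine Measure.ext_of_lintegral _ fun f hf => ?_
  have hf' : Measurable fun p => ∫⁻ z, f (p, z) ∂(obsAfter S i t p) :=
    hf.lintegral_kernel_prod_right'
  rw [Measure.lintegral_compProd hf, lintegral_map hf (by fun_prop),
    lintegral_map hf' (by fun_prop)]
  have h1 := lintegral_trajLaw_step S π i t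
    (g := fun p => f ((p.1, p.2.1), p.2.2)) (by fun_prop)
  have h2 := lintegral_trajLaw_step S π i t
    (g := fun p => ∫⁻ z, f ((p.1, p.2.1), z) ∂(obsAfter S i t (p.1, p.2.1)))
    (hf'.comp (by fun_prop : Measurable fun p : (Fin t → Step A Z) × Step A Z => (p.1, p.2.1)))
  refine h1.trans (Eq.trans (lintegral_congr fun x => ?_) h2.symm)
  rw [lintegral_stepKernel _ _ _ _ _ (by fun_prop), lintegral_stepKernel]
  · simp only [lintegral_const, measure_univ, mul_one]
    rfl
  · exact hf'.comp (by fun_prop : Measurable fun s : Step A Z => (past t x, s.1))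

end

/-! ### Change of measure along the trajectory -/

section

-- Unification would otherwise unfold `withDensity` when comparing laws of equal actions.
attribute [local irreducible] Model.obs

section

variable {α : Type*} [MeasurableSpace α]

/-- Only an inequality, since `ν` may charge sets which are null for `μ`. -/
theorem lintegral_mul_exp_neg_llr_le {μ ν : Measure α} [SigmaFinite μ] [SigmaFinite ν]
    (hμν : μ ≪ ν) {f : α → ℝ≥0∞} (hf : Measurable f) :
    ∫⁻ z, f z * ENNReal.ofReal (Real.exp (-llr μ ν z)) ∂μ ≤ ∫⁻ z, f z ∂ν := by
  calc ∫⁻ z, f z * ENNReal.ofReal (Real.exp (-llr μ ν z)) ∂μ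
      = ∫⁻ z, (ν.rnDeriv μ * f) z ∂μ := by
        refine lintegral_congr_ae ?_
        filter_upwards [exp_neg_llr hμν, ν.rnDeriv_lt_top μ] with z hz hz'
        rw [hz, ENNReal.ofReal_toReal hz'.ne, mul_comm]
        rfl
    _ = ∫⁻ z, f z ∂(μ.withDensity (ν.rnDeriv μ)) :=
        (lintegral_withDensity_eq_lintegral_mul μ (ν.measurable_rnDeriv μ) hf).symm
    _ ≤ ∫⁻ z, f z ∂ν := lintegral_mono' (Measure.withDensity_rnDeriv_le ν μ) le_rfl

end

theorem past_succ {A Z : Type*} (t : ℕ) (x : ℕ → Step A Z) :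
    past (t + 1) x = Fin.snoc (past t x) (x t) := by
  funext k
  induction k using Fin.lastCases with
  | last => simp [past]
  | cast k => simp [past]

variable {M : ℕ} {A Z : Type*} [MeasurableSpace Z]

/-- The log-likelihood ratio, in nats, of hypothesis `i` against `j` carried by one step. -/
def stepLLR (S : Model M A Z) (i j : Fin M) (s : Step A Z) : ℝ :=
  llr (S.obs s.1.2 i) (S.obs s.1.2 j) s.2

/-- The log-likelihood ratio of `i` against `j` accumulated before time `t`, retired or not. -/
def sumLLR (S : Model M A Z) (i j : Fin M) (t : ℕ) (x : ℕ → Step A Z) : ℝ :=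
  ∑ k ∈ Finset.range t, stepLLR S i j (x k)

variable [MeasurableSpace A] [Finite A] [MeasurableSingletonClass A]

theorem measurable_llr_family (μ ν : A → Measure Z) :
    Measurable fun s : Step A Z => llr (μ s.1.2) (ν s.1.2) s.2 := by
  have h : Measurable fun p : A × Z => llr (μ p.1) (ν p.1) p.2 := by
    refine measurable_from_prod_countable_right fun a => ?_
    exact measurable_llr (μ a) (ν a)
  have h2 : Measurable fun s : Step A Z => (s.1.2, s.2) := by fun_prop
  exact h.comp h2

@[fun_prop]
theorem measurable_stepLLR (S : Model M A Z) (i j : Fin M) : Measurable (stepLLR S i j) :=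
  measurable_llr_family (fun a => S.obs a i) (fun a => S.obs a j)

@[fun_prop]
theorem measurable_sumLLR (S : Model M A Z) (i j : Fin M) (t : ℕ) :
    Measurable (sumLLR S i j t) := by
  unfold sumLLR; fun_prop

theorem measurable_finSnoc {X : Type*} [MeasurableSpace X] (t : ℕ) :
    Measurable fun p : (Fin t → X) × X => (Fin.snoc p.1 p.2 : Fin (t + 1) → X) := by
  refine measurable_pi_iff.2 fun k => ?_
  induction k using Fin.lastCases with
  | last => simpa using measurable_snd
  | cast k => simp only [Fin.snoc_castSucc]; fun_prop

theorem lintegral_stepKernel_mul_exp_neg_stepLLR_le (S : Model M A Z) (π : Strategy M A Z)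
    {i j : Fin M} (hac : ∀ a, S.obs a i ≪ S.obs a j) (t : ℕ) (h : Fin t → A × Z)
    {f : Step A Z → ℝ≥0∞} (hf : Measurable f) :
    ∫⁻ s, f s * ENNReal.ofReal (Real.exp (-stepLLR S i j s)) ∂(stepKernel S π i t h) ≤
      ∫⁻ s, f s ∂(stepKernel S π j t h) := by
  rw [lintegral_stepKernel _ _ _ _ _ (by fun_prop), lintegral_stepKernel _ _ _ _ _ hf]
  exact lintegral_mono fun p => lintegral_mul_exp_neg_llr_le (hac p.2) (by fun_prop)

/-- Change of measure along a finite horizon. -/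
theorem lintegral_past_mul_exp_neg_sumLLR_le (S : Model M A Z) (π : Strategy M A Z)
    {i j : Fin M} (hac : ∀ a, S.obs a i ≪ S.obs a j) (t : ℕ)
    {g : (Fin t → Step A Z) → ℝ≥0∞} (hg : Measurable g) :
    ∫⁻ x, g (past t x) * ENNReal.ofReal (Real.exp (-sumLLR S i j t x)) ∂(trajLaw S π i) ≤
      ∫⁻ x, g (past t x) ∂(trajLaw S π j) := by
  induction t with
  | zero =>
    have h1 : ∀ x : ℕ → Step A Z, past 0 x = fun k => k.elim0 := fun x =>
      funext fun k => k.elim0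
    simp [h1, sumLLR]
  | succ t ih =>
    let Λ : (Fin t → Step A Z) → ℝ≥0∞ := fun y =>
      ENNReal.ofReal (Real.exp (-∑ k : Fin t, stepLLR S i j (y k)))
    have hΛ : Measurable Λ := by fun_prop
    have hΛ' : ∀ x, ENNReal.ofReal (Real.exp (-sumLLR S i j t x)) = Λ (past t x) := fun x => by
      simp only [Λ, sumLLR, past, Finset.sum_range]
    have hG : Measurable fun p : (Fin t → Step A Z) × Step A Z =>
        g (Fin.snoc p.1 p.2) := hg.comp (measurable_finSnoc t)
    have hk : Measurable fun y : Fin t → Step A Z =>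
        ∫⁻ s, g (Fin.snoc y s) ∂(stepKernel S π j t (eraseFlags y)) :=
      Measurable.lintegral_kernel_prod_right'
        (κ := (stepKernel S π j t).comap eraseFlags (measurable_eraseFlags t)) hG
    calc ∫⁻ x, g (past (t + 1) x) *
          ENNReal.ofReal (Real.exp (-sumLLR S i j (t + 1) x)) ∂(trajLaw S π i)
        = ∫⁻ x, (fun p : (Fin t → Step A Z) × Step A Z => Λ p.1 * (g (Fin.snoc p.1 p.2) *
            ENNReal.ofReal (Real.exp (-stepLLR S i j p.2)))) (past t x, x t)
              ∂(trajLaw S π i) := by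
          refine lintegral_congr fun x => ?_
          simp only [past_succ, ← hΛ']
          rw [mul_left_comm, ← ENNReal.ofReal_mul (Real.exp_nonneg _), ← Real.exp_add]
          simp only [sumLLR, Finset.sum_range_succ, neg_add]
      _ = ∫⁻ x, Λ (past t x) * ∫⁻ s, g (Fin.snoc (past t x) s) *
            ENNReal.ofReal (Real.exp (-stepLLR S i j s))
              ∂(stepKernel S π i t (eraseFlags (past t x))) ∂(trajLaw S π i) := by
          refine (lintegral_trajLaw_step S π i t (g := fun p : (Fin t → Step A Z) × Step A Z =>
            Λ p.1 * (g (Fin.snoc p.1 p.2) * ENNReal.ofReal (Real.exp (-stepLLR S i j p.2))))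
            ((hΛ.comp measurable_fst).mul (hG.mul (by fun_prop)))).trans
              (lintegral_congr fun x => ?_)
          exact lintegral_const_mul (Λ (past t x)) (f := fun s => g (Fin.snoc (past t x) s) *
            ENNReal.ofReal (Real.exp (-stepLLR S i j s))) ((hG.comp measurable_prodMk_left).mul
              (by fun_prop : Measurable fun s => ENNReal.ofReal (Real.exp (-stepLLR S i j s))))
      _ ≤ ∫⁻ x, (∫⁻ s, g (Fin.snoc (past t x) s)
            ∂(stepKernel S π j t (eraseFlags (past t x)))) *
              ENNReal.ofReal (Real.exp (-sumLLR S i j t x)) ∂(trajLaw S π i) := by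
          refine lintegral_mono fun x => ?_
          rw [hΛ', mul_comm]
          refine mul_le_mul_left ?_ _
          exact lintegral_stepKernel_mul_exp_neg_stepLLR_le S π hac t _
            (f := fun s => g (Fin.snoc (past t x) s)) (hG.comp measurable_prodMk_left)
      _ ≤ ∫⁻ x, ∫⁻ s, g (Fin.snoc (past t x) s)
            ∂(stepKernel S π j t (eraseFlags (past t x))) ∂(trajLaw S π j) := ih hk
      _ = ∫⁻ x, g (past (t + 1) x) ∂(trajLaw S π j) := by
          rw [← lintegral_trajLaw_step S π j t hG]
          simp only [past_succ]

/-- Change of measure on the events known just before an observation: the flag and action of time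
`t` are drawn from the same kernel under both hypotheses. -/
theorem setLIntegral_exp_neg_sumLLR_le (S : Model M A Z) (π : Strategy M A Z)
    {i j : Fin M} (hac : ∀ a, S.obs a i ≪ S.obs a j) (t : ℕ)
    {B : Set ((Fin t → Step A Z) × (Bool × A))} (hB : MeasurableSet B) :
    ∫⁻ x in beforeObs t ⁻¹' B, ENNReal.ofReal (Real.exp (-sumLLR S i j t x)) ∂(trajLaw S π i) ≤
      trajLaw S π j (beforeObs t ⁻¹' B) := by
  let f : (Fin t → Step A Z) × Step A Z → ℝ≥0∞ := fun p => B.indicator 1 (p.1, p.2.1)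
  have hf : Measurable f := (measurable_one.indicator hB).comp (by fun_prop)
  let Λ : (Fin t → Step A Z) → ℝ≥0∞ := fun y =>
    ENNReal.ofReal (Real.exp (-∑ k : Fin t, stepLLR S i j (y k)))
  have hΛ : Measurable Λ := by fun_prop
  have hΛ' : ∀ x, ENNReal.ofReal (Real.exp (-sumLLR S i j t x)) = Λ (past t x) := fun x => by
    simp only [Λ, sumLLR, past, Finset.sum_range]
  have hk : ∀ l, Measurable fun y : Fin t → Step A Z =>
      ∫⁻ s, f (y, s) ∂(stepKernel S π l t (eraseFlags y)) := fun l =>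
    Measurable.lintegral_kernel_prod_right'
      (κ := (stepKernel S π l t).comap eraseFlags (measurable_eraseFlags t)) hf
  have hij : ∀ y : Fin t → Step A Z, ∫⁻ s, f (y, s) ∂(stepKernel S π i t (eraseFlags y)) =
      ∫⁻ s, f (y, s) ∂(stepKernel S π j t (eraseFlags y)) := fun y => by
    rw [lintegral_stepKernel _ _ _ _ _ (by fun_prop), lintegral_stepKernel _ _ _ _ _ (by fun_prop)]
    simp [f]
  have hBm : MeasurableSet (beforeObs t ⁻¹' B) := measurable_beforeObs t hB
  calc ∫⁻ x in beforeObs t ⁻¹' B, ENNReal.ofReal (Real.exp (-sumLLR S i j t x)) ∂(trajLaw S π i)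
      = ∫⁻ x, (fun p : (Fin t → Step A Z) × Step A Z => Λ p.1 * f p) (past t x, x t)
          ∂(trajLaw S π i) := by
        rw [← lintegral_indicator hBm]
        refine lintegral_congr fun x => ?_
        by_cases hx : beforeObs t x ∈ B
        · have hx' : (past t x, (x t).1) ∈ B := hx
          simp [Set.indicator, hx, hx', f, hΛ']
        · have hx' : (past t x, (x t).1) ∉ B := hx
          simp [Set.indicator, hx, hx', f]
    _ = ∫⁻ x, (∫⁻ s, f (past t x, s) ∂(stepKernel S π j t (eraseFlags (past t x)))) *
          ENNReal.ofReal (Real.exp (-sumLLR S i j t x)) ∂(trajLaw S π i) := by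
        refine (lintegral_trajLaw_step S π i t (g := fun p => Λ p.1 * f p)
          (by fun_prop)).trans (lintegral_congr fun x => ?_)
        refine (lintegral_const_mul (Λ (past t x)) (f := fun s => f (past t x, s))
          (hf.comp measurable_prodMk_left)).trans ?_
        rw [hΛ', hij, mul_comm]
    _ ≤ ∫⁻ x, ∫⁻ s, f (past t x, s) ∂(stepKernel S π j t (eraseFlags (past t x)))
          ∂(trajLaw S π j) := lintegral_past_mul_exp_neg_sumLLR_le S π hac t (hk j)
    _ = ∫⁻ x, f (past t x, x t) ∂(trajLaw S π j) := (lintegral_trajLaw_step S π j t hf).symm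
    _ = trajLaw S π j (beforeObs t ⁻¹' B) := by
        rw [← lintegral_indicator_one hBm]
        rfl

theorem integrable_stepLLR (S : Model M A Z) (π : Strategy M A Z) {i j : Fin M}
    (hint : ∀ a, Integrable (llr (S.obs a i) (S.obs a j)) (S.obs a i)) (t : ℕ) :
    Integrable (fun x => stepLLR S i j (x t)) (trajLaw S π i) := by
  have hm : Measurable fun p : ((Fin t → Step A Z) × (Bool × A)) × Z =>
      stepLLR S i j (p.1.2, p.2) := by fun_prop
  have h : Integrable (fun p : ((Fin t → Step A Z) × (Bool × A)) × Z =>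
      stepLLR S i j (p.1.2, p.2)) ((trajLaw S π i).map (beforeObs t) ⊗ₘ obsAfter S i t) := by
    have : IsProbabilityMeasure ((trajLaw S π i).map (beforeObs t)) :=
      Measure.isProbabilityMeasure_map (by fun_prop)
    rw [Measure.integrable_compProd_iff hm.aestronglyMeasurable]
    refine ⟨Filter.Eventually.of_forall fun p => hint p.2.2, ?_⟩
    have hfin : StronglyMeasurable fun p : (Fin t → Step A Z) × (Bool × A) =>
        ∫ z, ‖stepLLR S i j (p.2, z)‖ ∂(obsAfter S i t p) :=
      hm.norm.stronglyMeasurable.integral_kernel_prod_right'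
    obtain ⟨C, hC⟩ := Finite.exists_le fun a : A =>
      ∫ z, ‖llr (S.obs a i) (S.obs a j) z‖ ∂(S.obs a i)
    refine Integrable.of_bound hfin.aestronglyMeasurable C (Filter.Eventually.of_forall fun p => ?_)
    rw [Real.norm_of_nonneg (integral_nonneg fun _ => norm_nonneg _)]
    exact hC p.2.2
  rw [← trajLaw_map_beforeObs_compProd] at h
  exact (integrable_map_measure hm.aestronglyMeasurable (by fun_prop)).1 h

theorem integrable_sumLLR (S : Model M A Z) (π : Strategy M A Z) {i j : Fin M}
    (hint : ∀ a, Integrable (llr (S.obs a i) (S.obs a j)) (S.obs a i)) (t : ℕ) :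
    Integrable (sumLLR S i j t) (trajLaw S π i) :=
  integrable_finsetSum _ fun k _ => integrable_stepLLR S π hint k

/-- One observation increases the log-likelihood ratio on average by a divergence, on any event
known before that observation is made. -/
theorem setIntegral_stepLLR_le (S : Model M A Z) (π : Strategy M A Z) {i j : Fin M}
    (hint : ∀ a, Integrable (llr (S.obs a i) (S.obs a j)) (S.obs a i)) {D : ℝ}
    (hD : ∀ a, ∫ z, llr (S.obs a i) (S.obs a j) z ∂(S.obs a i) ≤ D) (t : ℕ)
    {B : Set ((Fin t → Step A Z) × (Bool × A))} (hB : MeasurableSet B) :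
    ∫ x in beforeObs t ⁻¹' B, stepLLR S i j (x t) ∂(trajLaw S π i) ≤
      D * (trajLaw S π i).real (beforeObs t ⁻¹' B) := by
  let F : ((Fin t → Step A Z) × (Bool × A)) × Z → ℝ := fun p => stepLLR S i j (p.1.2, p.2)
  have hF : Measurable F := by fun_prop
  have : IsProbabilityMeasure ((trajLaw S π i).map (beforeObs t)) :=
    Measure.isProbabilityMeasure_map (by fun_prop)
  have hI : Integrable F ((trajLaw S π i).map (beforeObs t) ⊗ₘ obsAfter S i t) := by
    rw [← trajLaw_map_beforeObs_compProd, integrable_map_measure hF.aestronglyMeasurable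
      (by fun_prop)]
    exact integrable_stepLLR S π hint t
  have h1 : ∫ x in beforeObs t ⁻¹' B, stepLLR S i j (x t) ∂(trajLaw S π i) =
      ∫ p in B ×ˢ Set.univ, F p ∂((trajLaw S π i).map (beforeObs t) ⊗ₘ obsAfter S i t) := by
    rw [← trajLaw_map_beforeObs_compProd, setIntegral_map (hB.prod MeasurableSet.univ)
      hF.aestronglyMeasurable (by fun_prop)]
    congr 2
    ext x
    simp
  have h2 : Integrable (fun p => ∫ z, F (p, z) ∂(obsAfter S i t p))
      ((trajLaw S π i).map (beforeObs t)) := Integrable.integral_compProd hI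
  rw [h1, Measure.setIntegral_compProd hB MeasurableSet.univ hI.integrableOn]
  simp only [Measure.restrict_univ]
  calc ∫ p in B, ∫ z, F (p, z) ∂(obsAfter S i t p) ∂((trajLaw S π i).map (beforeObs t))
      ≤ ∫ p in B, D ∂((trajLaw S π i).map (beforeObs t)) :=
        integral_mono h2.integrableOn (integrable_const _) fun p => hD p.2.2
    _ = D * (trajLaw S π i).real (beforeObs t ⁻¹' B) := by
        rw [setIntegral_const, smul_eq_mul, mul_comm, measureReal_def, measureReal_def,
          Measure.map_apply (by fun_prop) hB]

/-- The pointwise bound `log y ≤ y - 1` integrated against the change of measure. This is the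
Donsker–Varadhan inequality for the test function `c` on a single event. -/
theorem log_mul_sub_setIntegral_sumLLR_le (S : Model M A Z) (π : Strategy M A Z) {i j : Fin M}
    (hac : ∀ a, S.obs a i ≪ S.obs a j)
    (hint : ∀ a, Integrable (llr (S.obs a i) (S.obs a j)) (S.obs a i)) (t : ℕ) {c : ℝ} (hc : 0 < c)
    {B : Set ((Fin t → Step A Z) × (Bool × A))} (hB : MeasurableSet B) :
    Real.log c * (trajLaw S π i).real (beforeObs t ⁻¹' B) -
        ∫ x in beforeObs t ⁻¹' B, sumLLR S i j t x ∂(trajLaw S π i) ≤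
      c * (trajLaw S π j).real (beforeObs t ⁻¹' B) -
        (trajLaw S π i).real (beforeObs t ⁻¹' B) := by
  set E := beforeObs t ⁻¹' B with hE
  have hlin := setLIntegral_exp_neg_sumLLR_le S π hac t hB
  have hmeas : Measurable fun x => Real.exp (-sumLLR S i j t x) := by fun_prop
  have hexp : IntegrableOn (fun x => Real.exp (-sumLLR S i j t x)) E (trajLaw S π i) := by
    refine ⟨hmeas.aestronglyMeasurable, ?_⟩
    rw [hasFiniteIntegral_iff_ofReal (Filter.Eventually.of_forall fun _ => Real.exp_nonneg _)]
    exact hlin.trans_lt (measure_lt_top _ _)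
  have hexp_le : ∫ x in E, Real.exp (-sumLLR S i j t x) ∂(trajLaw S π i) ≤
      (trajLaw S π j).real E := by
    rw [integral_eq_lintegral_of_nonneg_ae (Filter.Eventually.of_forall fun _ => Real.exp_nonneg _)
      hmeas.aestronglyMeasurable]
    exact ENNReal.toReal_mono (measure_ne_top _ _) hlin
  have hs : IntegrableOn (sumLLR S i j t) E (trajLaw S π i) :=
    (integrable_sumLLR S π hint t).integrableOn
  have hmono : ∫ x in E, (Real.log c - sumLLR S i j t x) ∂(trajLaw S π i) ≤
      ∫ x in E, (c * Real.exp (-sumLLR S i j t x) - 1) ∂(trajLaw S π i) := by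
    refine integral_mono ((integrable_const _).sub hs)
      ((hexp.const_mul c).sub (integrable_const _)) fun x => ?_
    have := Real.log_le_sub_one_of_pos (mul_pos hc (Real.exp_pos (-sumLLR S i j t x)))
    rwa [Real.log_mul hc.ne' (Real.exp_ne_zero _), Real.log_exp, ← sub_eq_add_neg] at this
  rw [integral_sub (integrable_const _) hs, integral_sub (hexp.const_mul c) (integrable_const _),
    setIntegral_const, setIntegral_const, integral_const_mul] at hmono
  simp only [smul_eq_mul, mul_one] at hmono
  nlinarith [mul_le_mul_of_nonneg_left hexp_le hc.le]

end

/-! ### Retirement events and the expected retirement time -/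

section

section Events

variable {M : ℕ} {A Z : Type*}

/-- The trajectories along which the decision maker has not retired before time `t`. -/
def notRetired (A Z : Type*) (t : ℕ) : Set (ℕ → Step A Z) := {x | ∀ k < t, (x k).1.1 = false}

variable [MeasurableSpace A] [MeasurableSpace Z]

/-- The trajectories along which the decision maker retires at time `t` and declares `i`. -/
def retireCorrect (π : Strategy M A Z) (i : Fin M) (t : ℕ) : Set (ℕ → Step A Z) :=
  {x | x ∈ notRetired A Z t ∧ (x t).1.1 = true ∧ π.decl t (history t x) = i}

/-- The trajectories along which the decision maker retires at time `t` and does not declare `i`. -/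
def retireWrong (π : Strategy M A Z) (i : Fin M) (t : ℕ) : Set (ℕ → Step A Z) :=
  {x | x ∈ notRetired A Z t ∧ (x t).1.1 = true ∧ π.decl t (history t x) ≠ i}

omit [MeasurableSpace A] [MeasurableSpace Z] in
theorem retireTime_eq {t : ℕ} {x : ℕ → Step A Z} (hx : x ∈ notRetired A Z t)
    (ht : (x t).1.1 = true) : retireTime x = t := by
  refine le_antisymm (iInf₂_le t ht) (le_iInf₂ fun s hs => ?_)
  by_contra h
  have := hx s (by simpa using h)
  simp [hs] at this

omit [MeasurableSpace A] [MeasurableSpace Z] in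
theorem succ_le_retireTime {t : ℕ} {x : ℕ → Step A Z} (hx : x ∈ notRetired A Z (t + 1)) :
    ((t + 1 : ℕ) : ℕ∞) ≤ retireTime x := by
  refine le_iInf₂ fun s hs => ?_
  by_contra h
  have := hx s (by exact_mod_cast not_le.1 h)
  simp [hs] at this

omit [MeasurableSpace A] [MeasurableSpace Z] in
theorem notRetired_zero : notRetired A Z 0 = Set.univ := by
  ext x; simp [notRetired]

omit [MeasurableSpace A] [MeasurableSpace Z] in
theorem notRetired_anti {s t : ℕ} (h : s ≤ t) : notRetired A Z t ⊆ notRetired A Z s :=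
  fun _ hx k hk => hx k (hk.trans_le h)

theorem notRetired_eq_union (π : Strategy M A Z) (i : Fin M) (t : ℕ) :
    notRetired A Z t = (retireCorrect π i t ∪ retireWrong π i t) ∪ notRetired A Z (t + 1) := by
  ext x
  constructor
  · intro hx
    cases h : (x t).1.1 with
    | true =>
      by_cases hd : π.decl t (history t x) = i
      · exact Or.inl (Or.inl ⟨hx, h, hd⟩)
      · exact Or.inl (Or.inr ⟨hx, h, hd⟩)
    | false =>
      refine Or.inr fun k hk => ?_
      rcases Nat.lt_succ_iff_lt_or_eq.1 hk with hk | rfl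
      · exact hx k hk
      · exact h
  · rintro ((hx | hx) | hx)
    · exact hx.1
    · exact hx.1
    · exact notRetired_anti (Nat.le_succ t) hx

theorem disjoint_retireCorrect_retireWrong (π : Strategy M A Z) (i : Fin M) (t : ℕ) :
    Disjoint (retireCorrect π i t) (retireWrong π i t) :=
  Set.disjoint_left.2 fun _ h h' => h'.2.2 h.2.2

theorem disjoint_retire_notRetired (π : Strategy M A Z) (i : Fin M) (t : ℕ) :
    Disjoint (retireCorrect π i t ∪ retireWrong π i t) (notRetired A Z (t + 1)) := by
  refine Set.disjoint_left.2 fun x h h' => ?_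
  have h1 := h' t (Nat.lt_succ_self t)
  rcases h with h | h <;> simp [h.2.1] at h1

omit [MeasurableSpace A] [MeasurableSpace Z] in
theorem pairwise_disjoint_of_retire (f : ℕ → Set (ℕ → Step A Z))
    (hf : ∀ t, f t ⊆ {x | x ∈ notRetired A Z t ∧ (x t).1.1 = true}) :
    Pairwise (Function.onFun Disjoint f) := by
  intro s t hst
  refine Set.disjoint_left.2 fun x hs ht => hst ?_
  have h1 := retireTime_eq (hf s hs).1 (hf s hs).2
  rw [retireTime_eq (hf t ht).1 (hf t ht).2] at h1
  exact_mod_cast h1.symm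

/-- Not having retired before time `t` is known before the observation of time `t`. This form of
measurability, here and for the retirement events, is what the change of measure asks for. -/
theorem exists_beforeObs_notRetired (t : ℕ) :
    ∃ B : Set ((Fin t → Step A Z) × (Bool × A)), MeasurableSet B ∧
      beforeObs t ⁻¹' B = notRetired A Z t := by
  refine ⟨⋂ k : Fin t, {p | (p.1 k).1.1 = false},
    MeasurableSet.iInter fun k => measurableSet_eq_fun (by fun_prop) (by fun_prop), ?_⟩
  ext x
  simp only [Set.preimage_iInter, Set.mem_iInter, Set.mem_preimage, Set.mem_ofPred_eq, notRetired,
    beforeObs, past]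
  exact ⟨fun h k hk => h ⟨k, hk⟩, fun h k => h k k.2⟩

theorem exists_beforeObs_notRetired_succ (t : ℕ) :
    ∃ B : Set ((Fin t → Step A Z) × (Bool × A)), MeasurableSet B ∧
      beforeObs t ⁻¹' B = notRetired A Z (t + 1) := by
  obtain ⟨B, hB, h⟩ := exists_beforeObs_notRetired (A := A) (Z := Z) t
  refine ⟨B ∩ {p | p.2.1 = false},
    hB.inter (measurableSet_eq_fun (by fun_prop) (by fun_prop)), ?_⟩
  rw [Set.preimage_inter, h]
  ext x
  constructor
  · rintro ⟨hx, ht⟩ k hk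
    rcases Nat.lt_succ_iff_lt_or_eq.1 hk with hk | rfl
    · exact hx k hk
    · exact ht
  · exact fun hx => ⟨notRetired_anti (Nat.le_succ t) hx, hx t (Nat.lt_succ_self t)⟩

theorem exists_beforeObs_retireCorrect (π : Strategy M A Z) (i : Fin M) (t : ℕ) :
    ∃ B : Set ((Fin t → Step A Z) × (Bool × A)), MeasurableSet B ∧
      beforeObs t ⁻¹' B = retireCorrect π i t := by
  obtain ⟨B, hB, h⟩ := exists_beforeObs_notRetired (A := A) (Z := Z) t
  have hd := π.measurable_decl t
  refine ⟨B ∩ ({p | p.2.1 = true} ∩ {p | π.decl t (eraseFlags p.1) = i}),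
    hB.inter ((measurableSet_eq_fun (by fun_prop) (by fun_prop)).inter
      (measurableSet_eq_fun (by fun_prop) (by fun_prop))), ?_⟩
  rw [Set.preimage_inter, h]
  rfl

theorem exists_beforeObs_retireWrong (π : Strategy M A Z) (i : Fin M) (t : ℕ) :
    ∃ B : Set ((Fin t → Step A Z) × (Bool × A)), MeasurableSet B ∧
      beforeObs t ⁻¹' B = retireWrong π i t := by
  obtain ⟨B, hB, h⟩ := exists_beforeObs_notRetired (A := A) (Z := Z) t
  have hd := π.measurable_decl t
  refine ⟨B ∩ ({p | p.2.1 = true} ∩ {p | π.decl t (eraseFlags p.1) = i}ᶜ),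
    hB.inter ((measurableSet_eq_fun (by fun_prop) (by fun_prop)).inter
      (measurableSet_eq_fun (by fun_prop) (by fun_prop)).compl), ?_⟩
  rw [Set.preimage_inter, h]
  rfl

theorem measurableSet_notRetired (t : ℕ) : MeasurableSet (notRetired A Z t) := by
  obtain ⟨B, hB, h⟩ := exists_beforeObs_notRetired (A := A) (Z := Z) t
  exact h ▸ measurable_beforeObs t hB

theorem measurableSet_retireCorrect (π : Strategy M A Z) (i : Fin M) (t : ℕ) :
    MeasurableSet (retireCorrect π i t) := by
  obtain ⟨B, hB, h⟩ := exists_beforeObs_retireCorrect π i t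
  exact h ▸ measurable_beforeObs t hB

theorem measurableSet_retireWrong (π : Strategy M A Z) (i : Fin M) (t : ℕ) :
    MeasurableSet (retireWrong π i t) := by
  obtain ⟨B, hB, h⟩ := exists_beforeObs_retireWrong π i t
  exact h ▸ measurable_beforeObs t hB

/-- The trajectories along which the decision maker retires and does not declare `i`. -/
def wrongSet (π : Strategy M A Z) (i : Fin M) : Set (ℕ → Step A Z) :=
  {x | ∃ t : ℕ, retireTime x = t ∧ π.decl t (history t x) ≠ i}

variable (μ : Measure (ℕ → Step A Z)) [IsFiniteMeasure μ]

theorem measureReal_notRetired (π : Strategy M A Z) (i : Fin M) (t : ℕ) :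
    μ.real (notRetired A Z t) = μ.real (retireCorrect π i t) + μ.real (retireWrong π i t) +
      μ.real (notRetired A Z (t + 1)) := by
  rw [notRetired_eq_union π i t, measureReal_union (disjoint_retire_notRetired π i t)
    (measurableSet_notRetired _), measureReal_union (disjoint_retireCorrect_retireWrong π i t)
    (measurableSet_retireWrong π i t)]

theorem sum_measureReal_retireWrong_le (π : Strategy M A Z) (i : Fin M) (n : ℕ) :
    ∑ t ∈ Finset.range n, μ.real (retireWrong π i t) ≤ μ.real (wrongSet π i) := by
  rw [← measureReal_biUnion_finset
    (fun s _ t _ hst => pairwise_disjoint_of_retire (retireWrong π i)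
      (fun t x hx => ⟨hx.1, hx.2.1⟩) hst) fun t _ => measurableSet_retireWrong π i t]
  refine measureReal_mono ?_
  refine Set.iUnion₂_subset fun t _ x hx => ⟨t, retireTime_eq hx.1 hx.2.1, hx.2.2⟩

theorem sum_measureReal_retireCorrect_le (π : Strategy M A Z) {i j : Fin M} (hij : i ≠ j)
    (n : ℕ) :
    ∑ t ∈ Finset.range n, μ.real (retireCorrect π i t) ≤ μ.real (wrongSet π j) := by
  rw [← measureReal_biUnion_finset
    (fun s _ t _ hst => pairwise_disjoint_of_retire (retireCorrect π i)
      (fun t x hx => ⟨hx.1, hx.2.1⟩) hst) fun t _ => measurableSet_retireCorrect π i t]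
  refine measureReal_mono ?_
  exact Set.iUnion₂_subset fun t _ x hx =>
    ⟨t, retireTime_eq hx.1 hx.2.1, fun h => hij (hx.2.2.symm.trans h)⟩

theorem sum_retire_add_notRetired (π : Strategy M A Z) (i : Fin M) (n : ℕ) :
    ∑ t ∈ Finset.range n, μ.real (retireCorrect π i t) +
      ∑ t ∈ Finset.range n, μ.real (retireWrong π i t) + μ.real (notRetired A Z n) =
        μ.real Set.univ := by
  induction n with
  | zero => simp [notRetired_zero]
  | succ n ih =>
    rw [Finset.sum_range_succ, Finset.sum_range_succ, ← ih, measureReal_notRetired μ π i n]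
    ring

/-- The expected retirement time, as the sum of the tail probabilities `P(τ > t)`. In this form it
involves measurable sets only, and it is infinite if retirement may fail to happen. -/
def expectedTime (μ : Measure (ℕ → Step A Z)) : ℝ≥0∞ := ∑' t, μ (notRetired A Z (t + 1))

omit [IsFiniteMeasure μ] in
variable {μ} in
theorem sum_measureReal_notRetired_le (hμ : expectedTime μ ≠ ∞) (n : ℕ) :
    ∑ t ∈ Finset.range n, μ.real (notRetired A Z (t + 1)) ≤ (expectedTime μ).toReal := by
  have h := ENNReal.sum_le_tsum (f := fun t => μ (notRetired A Z (t + 1))) (Finset.range n)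
  have hfin : ∀ t ∈ Finset.range n, μ (notRetired A Z (t + 1)) ≠ ∞ := fun t ht =>
    ne_top_of_le_ne_top hμ (ENNReal.le_tsum t)
  calc ∑ t ∈ Finset.range n, μ.real (notRetired A Z (t + 1))
      = (∑ t ∈ Finset.range n, μ (notRetired A Z (t + 1))).toReal :=
        (ENNReal.toReal_sum hfin).symm
    _ ≤ (expectedTime μ).toReal := ENNReal.toReal_mono hμ h

variable {μ} in
theorem mul_measureReal_notRetired_le (hμ : expectedTime μ ≠ ∞) (n : ℕ) :
    n * μ.real (notRetired A Z n) ≤ (expectedTime μ).toReal := by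
  refine le_trans ?_ (sum_measureReal_notRetired_le hμ n)
  calc (n : ℝ) * μ.real (notRetired A Z n) = ∑ _t ∈ Finset.range n, μ.real (notRetired A Z n) := by
        simp
    _ ≤ _ := Finset.sum_le_sum fun t ht =>
        measureReal_mono (notRetired_anti (Nat.succ_le_iff.2 (Finset.mem_range.1 ht)))

end Events

variable {M : ℕ} {A Z : Type*} [MeasurableSpace Z] [MeasurableSpace A] [Finite A]
  [MeasurableSingletonClass A]

/-- The accumulated form of the Donsker–Varadhan inequality over the first `n` times, with test
function `c` where `i` is declared and `1` elsewhere. The log-likelihood ratio of the trajectories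
still running is kept as a boundary term. -/
theorem log_mul_sum_retireCorrect_le (S : Model M A Z) (π : Strategy M A Z) {i j : Fin M}
    (hac : ∀ a, S.obs a i ≪ S.obs a j)
    (hint : ∀ a, Integrable (llr (S.obs a i) (S.obs a j)) (S.obs a i)) {D : ℝ}
    (hD : ∀ a, ∫ z, llr (S.obs a i) (S.obs a j) z ∂(S.obs a i) ≤ D) {c : ℝ} (hc : 0 < c) (n : ℕ) :
    Real.log c * ∑ t ∈ Finset.range n, (trajLaw S π i).real (retireCorrect π i t) +
        ∫ x in notRetired A Z n, sumLLR S i j n x ∂(trajLaw S π i) ≤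
      D * ∑ t ∈ Finset.range n, (trajLaw S π i).real (notRetired A Z (t + 1)) +
        c * ∑ t ∈ Finset.range n, (trajLaw S π j).real (retireCorrect π i t) +
        ∑ t ∈ Finset.range n, (trajLaw S π j).real (retireWrong π i t) -
        (1 - (trajLaw S π i).real (notRetired A Z n)) := by
  induction n with
  | zero => simp [notRetired_zero, sumLLR]
  | succ n ih =>
    simp only [Finset.sum_range_succ (n := n)]
    obtain ⟨B₁, hB₁, h₁⟩ := exists_beforeObs_retireCorrect π i n
    obtain ⟨B₂, hB₂, h₂⟩ := exists_beforeObs_retireWrong π i n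
    obtain ⟨B₃, hB₃, h₃⟩ := exists_beforeObs_notRetired_succ (A := A) (Z := Z) n
    have e₁ := log_mul_sub_setIntegral_sumLLR_le S π hac hint n hc hB₁
    have e₂ := log_mul_sub_setIntegral_sumLLR_le S π hac hint n one_pos hB₂
    have e₃ := setIntegral_stepLLR_le S π hint hD n hB₃
    rw [h₁] at e₁
    rw [h₂] at e₂
    rw [h₃] at e₃
    have hs := integrable_sumLLR S π hint n
    have hsplit : ∫ x in notRetired A Z n, sumLLR S i j n x ∂(trajLaw S π i) =
        ∫ x in retireCorrect π i n, sumLLR S i j n x ∂(trajLaw S π i) +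
        ∫ x in retireWrong π i n, sumLLR S i j n x ∂(trajLaw S π i) +
        ∫ x in notRetired A Z (n + 1), sumLLR S i j n x ∂(trajLaw S π i) := by
      rw [notRetired_eq_union π i n, setIntegral_union (disjoint_retire_notRetired π i n)
        (measurableSet_notRetired _) hs.integrableOn hs.integrableOn,
        setIntegral_union (disjoint_retireCorrect_retireWrong π i n)
        (measurableSet_retireWrong π i n) hs.integrableOn hs.integrableOn]
    have hnext : ∫ x in notRetired A Z (n + 1), sumLLR S i j (n + 1) x ∂(trajLaw S π i) =
        ∫ x in notRetired A Z (n + 1), sumLLR S i j n x ∂(trajLaw S π i) +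
        ∫ x in notRetired A Z (n + 1), stepLLR S i j (x n) ∂(trajLaw S π i) := by
      rw [← integral_add hs.integrableOn (integrable_stepLLR S π hint n).integrableOn]
      simp only [sumLLR, Finset.sum_range_succ]
    have hprob := measureReal_notRetired (trajLaw S π i) π i n
    rw [Real.log_one] at e₂
    linarith

/-- The lower bound on the expected retirement time under hypothesis `i`: telling `i` from `j` with
the error probabilities of the strategy takes at least a number of observations of order
`log (1 / b) / D`, where `b` bounds the probability of a wrong declaration under `j`. -/
theorem one_sub_wrong_mul_log_le (S : Model M A Z) (π : Strategy M A Z) {i j : Fin M} (hij : i ≠ j)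
    (hac : ∀ a, S.obs a i ≪ S.obs a j)
    (hint : ∀ a, Integrable (llr (S.obs a i) (S.obs a j)) (S.obs a i)) {D : ℝ} (hD0 : 0 ≤ D)
    (hD : ∀ a, ∫ z, llr (S.obs a i) (S.obs a j) z ∂(S.obs a i) ≤ D)
    (hT : expectedTime (trajLaw S π i) ≠ ∞) {b : ℝ} (hb : 0 < b) (hb1 : b ≤ 1)
    (hjb : (trajLaw S π j).real (wrongSet π j) ≤ b) :
    (1 - (trajLaw S π i).real (wrongSet π i)) * Real.log b⁻¹ ≤
      D * (expectedTime (trajLaw S π i)).toReal + 1 := by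
  set T := (expectedTime (trajLaw S π i)).toReal
  have hlog : 0 ≤ Real.log b⁻¹ := Real.log_nonneg ((one_le_inv₀ hb).2 hb1)
  have key : ∀ n : ℕ, (1 - (trajLaw S π i).real (wrongSet π i) -
      (trajLaw S π i).real (notRetired A Z n)) * Real.log b⁻¹ ≤ D * T + 1 := fun n => by
    have h1 := log_mul_sum_retireCorrect_le S π hac hint hD (inv_pos.2 hb) n
    obtain ⟨B, hB, hBn⟩ := exists_beforeObs_notRetired (A := A) (Z := Z) n
    have h2 := log_mul_sub_setIntegral_sumLLR_le S π hac hint n one_pos hB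
    rw [hBn, Real.log_one] at h2
    have h3 := sum_retire_add_notRetired (trajLaw S π i) π i n
    have h4 := sum_retire_add_notRetired (trajLaw S π j) π i n
    rw [probReal_univ] at h3 h4
    have h5 := sum_measureReal_retireWrong_le (trajLaw S π i) π i n
    have h6 := (sum_measureReal_retireCorrect_le (trajLaw S π j) π hij n).trans hjb
    have h7 := mul_le_mul_of_nonneg_left (sum_measureReal_notRetired_le hT n) hD0
    have h8 : b⁻¹ * ∑ t ∈ Finset.range n, (trajLaw S π j).real (retireCorrect π i t) ≤ 1 := by
      rw [← inv_mul_cancel₀ hb.ne']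
      exact mul_le_mul_of_nonneg_left h6 (inv_nonneg.2 hb.le)
    have h9 : 0 ≤ ∑ t ∈ Finset.range n, (trajLaw S π j).real (retireCorrect π i t) :=
      Finset.sum_nonneg fun _ _ => measureReal_nonneg
    have h10 := mul_le_mul_of_nonneg_right (show 1 - (trajLaw S π i).real (wrongSet π i) -
      (trajLaw S π i).real (notRetired A Z n) ≤
        ∑ t ∈ Finset.range n, (trajLaw S π i).real (retireCorrect π i t) by linarith) hlog
    linarith
  -- By Markov's inequality the probability of still running at time `n` is at most `T / n`.
  have hlim : Filter.Tendsto (fun n : ℕ => (1 - (trajLaw S π i).real (wrongSet π i) -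
      (trajLaw S π i).real (notRetired A Z n)) * Real.log b⁻¹) Filter.atTop
        (nhds ((1 - (trajLaw S π i).real (wrongSet π i) - 0) * Real.log b⁻¹)) := by
    refine (tendsto_const_nhds.sub ?_).mul_const _
    refine squeeze_zero' (g := fun n : ℕ => T / n)
      (Filter.Eventually.of_forall fun _ => measureReal_nonneg) ?_
      (tendsto_const_div_atTop_nhds_zero_nat T)
    filter_upwards [Filter.eventually_gt_atTop 0] with n hn
    rw [le_div_iff₀ (by exact_mod_cast hn), mul_comm]
    exact mul_measureReal_notRetired_le hT n
  rw [sub_zero] at hlim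
  exact le_of_tendsto' hlim key

end

/-! ### The expected cost and the bound on `lowerSum` -/

section

section

variable {A Z : Type*} [MeasurableSpace A] [MeasurableSpace Z]

omit [MeasurableSpace A] [MeasurableSpace Z] in
theorem tsum_indicator_notRetired_le_retireTime (x : ℕ → Step A Z) :
    ∑' t, (notRetired A Z (t + 1)).indicator (1 : (ℕ → Step A Z) → ℝ≥0∞) x ≤
      (retireTime x : ℝ≥0∞) := by
  refine ENNReal.tsum_le_of_sum_range_le fun n => ?_
  induction n with
  | zero => simp
  | succ n ih =>
    by_cases hx : x ∈ notRetired A Z (n + 1)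
    · have h1 : ∑ t ∈ Finset.range (n + 1),
          (notRetired A Z (t + 1)).indicator (1 : (ℕ → Step A Z) → ℝ≥0∞) x ≤ (n + 1 : ℕ) := by
        refine (Finset.sum_le_card_nsmul _ _ 1 fun t _ => ?_).trans (by simp)
        exact Set.indicator_le_self' (fun _ _ => zero_le) x
      refine h1.trans ?_
      exact_mod_cast ENat.toENNReal_le.2 (succ_le_retireTime hx)
    · rw [Finset.sum_range_succ, Set.indicator_of_notMem hx, add_zero]
      exact ih

theorem measurable_tsum_indicator_notRetired :
    Measurable fun x => ∑' t,
      (notRetired A Z (t + 1)).indicator (1 : (ℕ → Step A Z) → ℝ≥0∞) x :=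
  Measurable.tsum fun _ => measurable_one.indicator (measurableSet_notRetired _)

theorem lintegral_tsum_indicator_notRetired (μ : Measure (ℕ → Step A Z)) :
    ∫⁻ x, ∑' t, (notRetired A Z (t + 1)).indicator (1 : (ℕ → Step A Z) → ℝ≥0∞) x ∂μ =
      expectedTime μ := by
  rw [lintegral_tsum fun t =>
    (measurable_one.indicator (measurableSet_notRetired (t + 1))).aemeasurable, expectedTime]
  exact tsum_congr fun t => lintegral_indicator_one (measurableSet_notRetired _)

end

variable {M : ℕ} {A Z : Type*} [MeasurableSpace Z] [MeasurableSpace A] [Finite A]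
  [MeasurableSingletonClass A]

theorem sum_mul_expectedTime_le (S : Model M A Z) (π : Strategy M A Z) (ρ : Fin M → ℝ) :
    ∑ i, ENNReal.ofReal (ρ i) * expectedTime (trajLaw S π i) ≤
      ∫⁻ ω, (retireTime ω.2 : ℝ≥0∞) ∂(jointLaw S π ρ) := by
  have hm := measurable_tsum_indicator_notRetired (A := A) (Z := Z)
  calc ∑ i, ENNReal.ofReal (ρ i) * expectedTime (trajLaw S π i)
      = ∫⁻ ω, ∑' t, (notRetired A Z (t + 1)).indicator (1 : (ℕ → Step A Z) → ℝ≥0∞) ω.2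
          ∂(jointLaw S π ρ) := by
        rw [jointLaw, lintegral_finsetSum_measure]
        refine Finset.sum_congr rfl fun i _ => ?_
        rw [lintegral_smul_measure, Measure.dirac_prod, smul_eq_mul,
          lintegral_map (f := fun ω : Fin M × (ℕ → Step A Z) => ∑' t,
            (notRetired A Z (t + 1)).indicator (1 : (ℕ → Step A Z) → ℝ≥0∞) ω.2)
            (hm.comp measurable_snd) (by fun_prop),
          lintegral_tsum_indicator_notRetired]
    _ ≤ _ := lintegral_mono fun ω => tsum_indicator_notRetired_le_retireTime ω.2

theorem ofReal_mul_wrongSet_le (S : Model M A Z) (π : Strategy M A Z) (ρ : Fin M → ℝ)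
    (i : Fin M) :
    ENNReal.ofReal (ρ i) * trajLaw S π i (wrongSet π i) ≤
      jointLaw S π ρ (wrongDeclaration π) := by
  have h : trajLaw S π i (wrongSet π i) ≤
      (Measure.dirac i).prod (trajLaw S π i) (wrongDeclaration π) := by
    rw [Measure.dirac_prod]
    exact Measure.le_map_apply (by fun_prop) _
  rw [jointLaw, Measure.finsetSum_apply]
  refine le_trans ?_ (Finset.single_le_sum (f := fun k => (ENNReal.ofReal (ρ k) •
    (Measure.dirac k).prod (trajLaw S π k)) (wrongDeclaration π)) (fun _ _ => zero_le)
    (Finset.mem_univ i))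
  rw [Measure.smul_apply, smul_eq_mul]
  gcongr

instance isFiniteMeasure_jointLaw (S : Model M A Z) (π : Strategy M A Z) (ρ : Fin M → ℝ) :
    IsFiniteMeasure (jointLaw S π ρ) := by
  have : ∀ i, IsFiniteMeasure (ENNReal.ofReal (ρ i) •
      (Measure.dirac i).prod (trajLaw S π i)) := fun i =>
    Measure.smul_finite _ ENNReal.ofReal_ne_top
  unfold jointLaw; infer_instance

theorem mul_measureReal_wrongSet_le (S : Model M A Z) (π : Strategy M A Z) {ρ : Fin M → ℝ}
    {i : Fin M} (hρ : 0 ≤ ρ i) :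
    ρ i * (trajLaw S π i).real (wrongSet π i) ≤ (jointLaw S π ρ).real (wrongDeclaration π) := by
  have h := ENNReal.toReal_mono (measure_ne_top _ _) (ofReal_mul_wrongSet_le S π ρ i)
  rwa [ENNReal.toReal_mul, ENNReal.toReal_ofReal hρ] at h

theorem ofReal_le_cost (S : Model M A Z) (π : Strategy M A Z) {ρ : Fin M → ℝ}
    (hρ : ∀ i, 0 ≤ ρ i) {L : ℝ} (hL : 0 ≤ L) :
    ENNReal.ofReal (∑ i, ρ i * (expectedTime (trajLaw S π i)).toReal +
      L * (jointLaw S π ρ).real (wrongDeclaration π)) ≤ cost S L ρ π := by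
  refine ENNReal.ofReal_add_le.trans (add_le_add ?_ ?_)
  · rw [ENNReal.ofReal_sum_of_nonneg fun i _ => mul_nonneg (hρ i) ENNReal.toReal_nonneg]
    refine le_trans (Finset.sum_le_sum fun i _ => ?_) (sum_mul_expectedTime_le S π ρ)
    rw [ENNReal.ofReal_mul (hρ i)]
    exact mul_le_mul_right ENNReal.ofReal_toReal_le _
  · rw [ENNReal.ofReal_mul hL]
    exact mul_le_mul_right ENNReal.ofReal_toReal_le _

theorem expectedTime_ne_top (S : Model M A Z) (π : Strategy M A Z) {ρ : Fin M → ℝ} {L : ℝ}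
    (hc : cost S L ρ π ≠ ∞) {i : Fin M} (hi : 0 < ρ i) :
    expectedTime (trajLaw S π i) ≠ ∞ := by
  intro h
  have h1 : ENNReal.ofReal (ρ i) * expectedTime (trajLaw S π i) ≤ cost S L ρ π :=
    ((Finset.single_le_sum (f := fun k => ENNReal.ofReal (ρ k) * expectedTime (trajLaw S π k))
      (fun _ _ => zero_le) (Finset.mem_univ i)).trans (sum_mul_expectedTime_le S π ρ)).trans
      le_self_add
  rw [h, ENNReal.mul_top (ENNReal.ofReal_pos.2 hi).ne', top_le_iff] at h1
  exact hc h1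

omit [MeasurableSpace A] [Finite A] [MeasurableSingletonClass A] in
/-- A finite bound on the divergences in bits, turned into the conditions on log-likelihood ratios
in nats that the change of measure needs. -/
theorem llr_conditions_of_iSup_D_ne_top (S : Model M A Z) {i j : Fin M}
    (h : ⨆ a, S.D a i j ≠ ∞) (a : A) :
    S.obs a i ≪ S.obs a j ∧ Integrable (llr (S.obs a i) (S.obs a j)) (S.obs a i) ∧
      ∫ z, llr (S.obs a i) (S.obs a j) z ∂(S.obs a i) ≤
        (⨆ a, S.D a i j).toReal * Real.log 2 := by
  have hlog : 0 < Real.log 2 := Real.log_pos one_lt_two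
  have h1 : InformationTheory.klDiv (S.obs a i) (S.obs a j) ≤
      (⨆ a, S.D a i j) * ENNReal.ofReal (Real.log 2) := by
    rw [← ENNReal.div_le_iff (ENNReal.ofReal_pos.2 hlog).ne' ENNReal.ofReal_ne_top]
    exact le_iSup (fun a => S.D a i j) a
  have h2 : (⨆ a, S.D a i j) * ENNReal.ofReal (Real.log 2) ≠ ∞ :=
    ENNReal.mul_ne_top h ENNReal.ofReal_ne_top
  obtain ⟨hac, hint⟩ := InformationTheory.klDiv_ne_top_iff.1 (ne_top_of_le_ne_top h2 h1)
  refine ⟨hac, hint, ?_⟩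
  rw [← InformationTheory.toReal_klDiv_of_measure_eq hac (by simp)]
  have h3 := ENNReal.toReal_mono h2 h1
  rwa [ENNReal.toReal_mul, ENNReal.toReal_ofReal hlog.le] at h3

/-- The estimate of one summand, with `r = ρ_i`, `s = ρ_j`, overall error probability `p` and the
divergence `d` in nats. With `e = p + 1 / L`, the information needed is `log (s / e)` up to
constants, which differs from the target `log (L s / r)` by `log (L e)` and the entropy term
`-log r`. The former is absorbed by the penalty `L * p`, the latter is bounded after weighting
by `r`. -/
theorem mul_log_sub_log_div_le {r s L d m T α p : ℝ} (hr : 0 < r) (hr1 : r ≤ 1) (hs : 0 < s)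
    (hs1 : s ≤ 1) (hL : 1 < L) (hm : 0 < m) (hmd : m ≤ d) (hp : 0 ≤ p)
    (hT0 : 0 ≤ T) (hα : r * α ≤ p)
    (hT : (p + L⁻¹) / s ≤ 1 → (1 - α) * Real.log ((p + L⁻¹) / s)⁻¹ ≤ d * T + 1) :
    r * ((Real.log ((1 - L⁻¹) / L⁻¹) - Real.log (r / s)) / d) ≤
      r * T + 3 / m + r * (L * p + 1 + |(1 + Real.log m) / m|) := by
  have hL0 : 0 < L := one_pos.trans hL
  have hLi : 0 < L⁻¹ := inv_pos.2 hL0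
  have hd : 0 < d := hm.trans_le hmd
  set e := p + L⁻¹ with he
  have he0 : 0 < e := by positivity
  have hLe : L * e = L * p + 1 := by rw [he, mul_add, mul_inv_cancel₀ hL0.ne']
  have hLe1 : 1 ≤ L * e := by rw [hLe]; nlinarith
  have h1 : Real.log ((1 - L⁻¹) / L⁻¹) ≤ Real.log L := by
    have : (1 - L⁻¹) / L⁻¹ = L - 1 := by field_simp
    rw [this]
    exact Real.log_le_log (by linarith) (by linarith)
  have h2 : Real.log (e / s)⁻¹ = Real.log s - Real.log e := by
    rw [Real.log_inv, Real.log_div he0.ne' hs.ne']; ring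
  have h3 : Real.log (L * e) = Real.log L + Real.log e := Real.log_mul hL0.ne' he0.ne'
  have h4 : Real.log (r / s) = Real.log r - Real.log s := Real.log_div hr.ne' hs.ne'
  have hlogx : ∀ x : ℝ, 0 < x → -(x * Real.log x) ≤ 1 := fun x hx => by
    have h := Real.log_le_sub_one_of_pos (inv_pos.2 hx)
    rw [Real.log_inv] at h
    have := mul_le_mul_of_nonneg_left h hx.le
    rw [mul_sub, mul_inv_cancel₀ hx.ne'] at this
    linarith
  have h5 : r * (Real.log s - Real.log e) ≤ d * (r * T) + 2 := by
    have hrT : 0 ≤ d * (r * T) := by positivity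
    rcases le_or_gt (e / s) 1 with h | h
    · have hy : 0 ≤ Real.log s - Real.log e := by
        rw [← h2]; exact Real.log_nonneg ((one_le_inv₀ (by positivity)).2 h)
      have h6 := mul_le_mul_of_nonneg_left (hT h) hr.le
      rw [h2] at h6
      have h7 := mul_le_mul_of_nonneg_right (hα.trans (by rw [he]; linarith : p ≤ e)) hy
      have h8 := mul_nonpos_of_nonneg_of_nonpos he0.le (Real.log_nonpos hs.le hs1)
      have h9 := hlogx e he0
      nlinarith
    -- For `s < e` the left-hand side is nonpositive.
    · have : Real.log s ≤ Real.log e := Real.log_le_log hs ((one_le_div hs).1 h.le)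
      nlinarith
  have hX : r * (Real.log ((1 - L⁻¹) / L⁻¹) - Real.log (r / s)) ≤
      d * (r * T) + 3 + r * Real.log (L * e) := by
    have h6 := hlogx r hr
    have h7 := mul_le_mul_of_nonneg_left h1 hr.le
    rw [h4, h3]
    nlinarith
  have hlogLe : 0 ≤ Real.log (L * e) := Real.log_nonneg hLe1
  -- `log y ≤ y - 1` at `y = m * (L * e)`: the factor `m` cancels the later division by `m`.
  have h6 : Real.log (L * e) ≤ m * (L * p + 1 + |(1 + Real.log m) / m|) := by
    have h7 := Real.log_le_sub_one_of_pos (show 0 < m * (L * e) by positivity)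
    rw [Real.log_mul hm.ne' (by positivity), hLe] at h7
    have h8 : -(1 + Real.log m) ≤ m * |(1 + Real.log m) / m| := by
      rw [abs_div, abs_of_pos hm, mul_div_cancel₀ _ hm.ne']
      exact neg_le_abs _
    rw [hLe]
    linarith
  calc r * ((Real.log ((1 - L⁻¹) / L⁻¹) - Real.log (r / s)) / d)
      = (r * (Real.log ((1 - L⁻¹) / L⁻¹) - Real.log (r / s))) / d := by ring
    _ ≤ (d * (r * T) + 3 + r * Real.log (L * e)) / d := by gcongr
    _ = r * T + (3 + r * Real.log (L * e)) / d := by field_simp; ring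
    _ ≤ r * T + (3 + r * Real.log (L * e)) / m := by gcongr
    _ ≤ r * T + (3 + r * (m * (L * p + 1 + |(1 + Real.log m) / m|))) / m := by gcongr
    _ = r * T + 3 / m + r * (L * p + 1 + |(1 + Real.log m) / m|) := by
        rw [add_div, ← add_assoc]
        congr 1
        field_simp

theorem log2_ofReal_div {r s : ℝ} (hr : 0 < r) (hs : 0 < s) :
    log2 (ENNReal.ofReal r / ENNReal.ofReal s) = (Real.logb 2 (r / s) : ℝ) := by
  rw [← ENNReal.ofReal_div_of_pos hs, log2, ENNReal.log_ofReal_of_pos (div_pos hr hs),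
    ← EReal.coe_div, Real.logb]

theorem log2_ofReal_div_zero {r : ℝ} (hr : 0 < r) :
    log2 (ENNReal.ofReal r / ENNReal.ofReal 0) = ⊤ := by
  rw [ENNReal.ofReal_zero, ENNReal.div_zero (ENNReal.ofReal_pos.2 hr).ne', log2, ENNReal.log_top]
  exact EReal.top_div_of_pos_ne_top (EReal.coe_pos.2 (Real.log_pos one_lt_two)) (EReal.coe_ne_top _)

/-- The bound on a single summand of `lowerSum`; `m` is a lower bound, in nats, on the largest
divergences. -/
theorem mul_iSup_le (S : Model M A Z) (π : Strategy M A Z) {L : ℝ} (hL : 1 < L)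
    {ρ : Fin M → ℝ} (hρ : ρ ∈ stdSimplex ℝ (Fin M)) (hc : cost S L ρ π ≠ ∞) {m : ℝ} (hm : 0 < m)
    (hmD : ∀ i j : Fin M, i ≠ j → ⨆ a, S.D a i j ≠ ∞ → m ≤ (⨆ a, S.D a i j).toReal * Real.log 2)
    (i : Fin M) :
    (ρ i : EReal) * ⨆ (j : Fin M) (_ : j ≠ i),
      ((Real.logb 2 ((1 - L⁻¹) / L⁻¹) : ℝ) -
        log2 (ENNReal.ofReal (ρ i) / ENNReal.ofReal (ρ j))) / ((⨆ a, S.D a i j : ℝ≥0∞) : EReal) ≤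
    ((ρ i * (expectedTime (trajLaw S π i)).toReal + 3 / m +
      ρ i * (L * (jointLaw S π ρ).real (wrongDeclaration π) + 1 +
        |(1 + Real.log m) / m|) : ℝ) : EReal) := by
  set T := (expectedTime (trajLaw S π i)).toReal with hT
  have hT0 : 0 ≤ T := ENNReal.toReal_nonneg
  set p := (jointLaw S π ρ).real (wrongDeclaration π) with hp
  have hp0 : 0 ≤ p := measureReal_nonneg
  have hL0 : 0 < L := one_pos.trans hL
  have hle1 : ∀ k, ρ k ≤ 1 := fun k => (mem_Icc_of_mem_stdSimplex hρ k).2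
  set R := ρ i * T + 3 / m + ρ i * (L * p + 1 + |(1 + Real.log m) / m|) with hR
  have hR0 : 0 ≤ R := by have := hρ.1 i; positivity
  rcases (hρ.1 i).eq_or_lt with hi | hi
  · rw [← hi, EReal.coe_zero, zero_mul]
    exact_mod_cast hR0
  suffices h : ⨆ (j : Fin M) (_ : j ≠ i), ((Real.logb 2 ((1 - L⁻¹) / L⁻¹) : ℝ) -
        log2 (ENNReal.ofReal (ρ i) / ENNReal.ofReal (ρ j))) /
          ((⨆ a, S.D a i j : ℝ≥0∞) : EReal) ≤ ((R / ρ i : ℝ) : EReal) by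
    refine (mul_le_mul_of_nonneg_left h (EReal.coe_nonneg.2 hi.le)).trans ?_
    rw [← EReal.coe_mul, mul_div_cancel₀ _ hi.ne']
  refine iSup₂_le fun j hji => ?_
  -- An infinite divergence makes the quotient `0`.
  by_cases hD : ⨆ a, S.D a i j = ∞
  · rw [hD, EReal.coe_ennreal_top, EReal.div_top]
    exact_mod_cast div_nonneg hR0 hi.le
  have hlog : 0 < Real.log 2 := Real.log_pos one_lt_two
  have hmd := hmD i j hji.symm hD
  have hd0 : 0 < (⨆ a, S.D a i j).toReal := by
    by_contra h
    nlinarith [mul_nonpos_of_nonpos_of_nonneg (not_lt.1 h) hlog.le]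
  rw [← ENNReal.ofReal_toReal hD, EReal.coe_ennreal_ofReal, max_eq_left hd0.le]
  set d := (⨆ a, S.D a i j).toReal with hd
  rcases (hρ.1 j).eq_or_lt with hj | hj
  -- A rival of prior probability `0` contributes `-∞` to the supremum.
  · rw [← hj, log2_ofReal_div_zero hi, EReal.sub_top,
      EReal.bot_div_of_pos_ne_top (EReal.coe_pos.2 hd0) (EReal.coe_ne_top _)]
    exact bot_le
  have hcond := llr_conditions_of_iSup_D_ne_top S hD
  rw [log2_ofReal_div hi hj, ← EReal.coe_sub, ← EReal.coe_div, EReal.coe_le_coe_iff,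
    le_div_iff₀' hi]
  have hLi : 0 < L⁻¹ := inv_pos.2 hL0
  have hmain := mul_log_sub_log_div_le (d := d * Real.log 2) hi (hle1 i) hj (hle1 j) hL hm hmd hp0
    hT0 (mul_measureReal_wrongSet_le S π (hρ.1 i)) fun hb => by
      refine one_sub_wrong_mul_log_le S π hji.symm (fun a => (hcond a).1) (fun a => (hcond a).2.1)
        (by positivity) (fun a => (hcond a).2.2) (expectedTime_ne_top S π hc hi) (by positivity)
        hb ?_
      rw [le_div_iff₀' hj]
      exact (mul_measureReal_wrongSet_le S π (hρ.1 j)).trans (by linarith)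
  refine le_trans (le_of_eq ?_) hmain
  rw [Real.logb, Real.logb, ← sub_div, div_div, mul_comm d]

omit [MeasurableSpace A] [Finite A] [MeasurableSingletonClass A] in
theorem exists_pos_le_iSup_D (S : Model M A Z)
    (hsep : ∀ i j : Fin M, i ≠ j → ∃ a : A, 0 < S.D a i j) :
    ∃ m : ℝ, 0 < m ∧ ∀ i j : Fin M, i ≠ j → ⨆ a, S.D a i j ≠ ∞ →
      m ≤ (⨆ a, S.D a i j).toReal * Real.log 2 := by
  have h : ∀ p : Fin M × Fin M, ∃ ε : ℝ, 0 < ε ∧ (p.1 ≠ p.2 → ⨆ a, S.D a p.1 p.2 ≠ ∞ →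
      ε ≤ (⨆ a, S.D a p.1 p.2).toReal * Real.log 2) := fun p => by
    by_cases hp : p.1 ≠ p.2 ∧ ⨆ a, S.D a p.1 p.2 ≠ ∞
    · obtain ⟨a, ha⟩ := hsep p.1 p.2 hp.1
      have hpos : 0 < ⨆ a, S.D a p.1 p.2 := ha.trans_le (le_iSup (fun a => S.D a p.1 p.2) a)
      exact ⟨_, mul_pos (ENNReal.toReal_pos hpos.ne' hp.2) (Real.log_pos one_lt_two),
        fun _ _ => le_rfl⟩
    · exact ⟨1, one_pos, fun h1 h2 => absurd ⟨h1, h2⟩ hp⟩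
  choose ε hε hε' using h
  obtain ⟨m, hm⟩ := Finite.exists_le fun p => (ε p)⁻¹
  refine ⟨(max m 1)⁻¹, by positivity, fun i j hij hD => le_trans ?_ (hε' (i, j) hij hD)⟩
  exact inv_le_of_inv_le₀ (hε _) ((hm (i, j)).trans (le_max_left _ _))

end

end ActiveTesting

end

theorem theorem1 {M : ℕ} {A Z : Type*} [Finite A] [MeasurableSpace A] [MeasurableSingletonClass A]
    [MeasurableSpace Z] (S : ActiveTesting.Model M A Z)
    (hsep : ∀ i j : Fin M, i ≠ j → ∃ a : A, 0 < S.D a i j) :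
    ∃ K : ℝ, ∀ L : ℝ, 1 < L → ∀ ρ ∈ ActiveTesting.beliefRegion M L,
      max (ActiveTesting.lowerSum S L ρ - (K : EReal)) 0 ≤
        (ActiveTesting.optimalCost S L ρ : EReal) := by
  obtain ⟨m, hm, hmD⟩ := ActiveTesting.exists_pos_le_iSup_D S hsep
  -- `3 / m` for each hypothesis, and a constant common to all, weighted by the prior.
  refine ⟨M * (3 / m) + (1 + |(1 + Real.log m) / m|), fun L hL ρ hρ => ?_⟩
  have hρ := hρ.1
  rw [max_comm, ← EReal.coe_toENNReal_eq_max, EReal.coe_ennreal_le_coe_ennreal_iff,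
    ActiveTesting.optimalCost]
  refine le_iInf fun π => ?_
  by_cases hc : ActiveTesting.cost S L ρ π = ∞
  · rw [hc]
    exact le_top
  refine le_trans ?_ (ActiveTesting.ofReal_le_cost S π hρ.1 (one_pos.trans hL).le)
  rw [← EReal.real_coe_toENNReal]
  refine EReal.toENNReal_le_toENNReal ?_
  rw [EReal.sub_le_iff_le_add (Or.inl (EReal.coe_ne_bot _)) (Or.inl (EReal.coe_ne_top _)),
    ← EReal.coe_add]
  refine (Finset.sum_le_sum fun i _ => ActiveTesting.mul_iSup_le S π hL hρ hc hm hmD i).trans ?_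
  have hsum : ∀ (s : Finset (Fin M)) (f : Fin M → ℝ),
      ∑ i ∈ s, (f i : EReal) = ((∑ i ∈ s, f i : ℝ) : EReal) := fun s f =>
    (map_sum (⟨⟨Real.toEReal, EReal.coe_zero⟩, EReal.coe_add⟩ : ℝ →+ EReal) f s).symm
  rw [hsum, EReal.coe_le_coe_iff]
  simp only [Finset.sum_add_distrib, ← Finset.sum_mul, hρ.2, Finset.sum_const, Finset.card_univ,
    Fintype.card_fin, nsmul_eq_mul]
  linarith
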